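/- Fix an integer $p\ge 2$. For each $n\ge 2$ let $\mathbf X_1,\dots,\mathbf X_n$ be independent random points, each uniformly distributed on the unit sphere $\mathbb S^{p-1}$ of $\mathbb R^p$. For $1\le i<j\le n$ let $\Theta_{ij}\in[0,\pi]$ be the angle between the vectors $\mathbf X_i$ and $\mathbf X_j$, and put $$\Theta_{\min}=\min_{1\le i<j\le n}\Theta_{ij},\qquad \Theta_{\max}=\max_{1\le i<j\le n}\Theta_{ij}.$$ Then, as $n\to\infty$, both $n^{2/(p-1)}\,\Theta_{\min}$ and $n^{2/(p-1)}\,(\pi-\Theta_{\max})$ converge weakly (in distribution) to the probability distribution on $\mathbb R$ whose distribution function is $$F(x)=\begin{cases}1-e^{-Kx^{p-1}}, & x\ge 0,\\ 0, & x<0,\end{cases}\qquad\text{where}\quad K=\frac{1}{4\sqrt{\pi}}\,\frac{\Gamma(p/2)}{\Gamma((p+1)/2)}.$$ -/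

import Mathlib

open Filter MeasureTheory ProbabilityTheory

noncomputable section

/-- The unit sphere `𝕊^{p-1}` of the Euclidean space `ℝ^p`. -/
abbrev UnitSphere (p : ℕ) : Type :=
  Metric.sphere (0 : EuclideanSpace ℝ (Fin p)) 1

/-- The uniform distribution on `𝕊^{p-1}`: the surface measure
`(volume : Measure ℝ^p).toSphere`, normalized to total mass one. -/
def uniformSphere (p : ℕ) : Measure (UnitSphere p) :=
  ProbabilityTheory.cond
    ((volume : Measure (EuclideanSpace ℝ (Fin p))).toSphere) Set.univ

/-- The angle `Θ_{ij} ∈ [0, π]` between the `i`-th and the `j`-th point. -/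
def pairAngle {p n : ℕ} (x : Fin n → UnitSphere p) (i j : Fin n) : ℝ :=
  InnerProductGeometry.angle
    (x i : EuclideanSpace ℝ (Fin p)) (x j : EuclideanSpace ℝ (Fin p))

/-- `Θ_min`, the smallest of the angles `Θ_{ij}`, `i < j`. For `n ≥ 2` this is the minimum of a
finite nonempty family; for `n < 2` there are no pairs and the value is `0`. -/
def minAngle {p n : ℕ} (x : Fin n → UnitSphere p) : ℝ :=
  ⨅ q : {q : Fin n × Fin n // q.1 < q.2}, pairAngle x q.1.1 q.1.2

/-- `Θ_max`, the largest of the angles `Θ_{ij}`, `i < j` (again `0` for `n < 2`). -/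
def maxAngle {p n : ℕ} (x : Fin n → UnitSphere p) : ℝ :=
  ⨆ q : {q : Fin n × Fin n // q.1 < q.2}, pairAngle x q.1.1 q.1.2

/-- The constant `K = Γ(p/2) / (4 √π Γ((p+1)/2))`. -/
def extremeConst (p : ℕ) : ℝ :=
  1 / (4 * √Real.pi) * (Real.Gamma ((p : ℝ) / 2) / Real.Gamma (((p : ℝ) + 1) / 2))

/-- The limiting distribution function `F(x) = 1 - exp(-K x^{p-1})` for `x ≥ 0`,
and `F(x) = 0` for `x < 0`. -/
def extremeCDF (p : ℕ) (x : ℝ) : ℝ :=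
  if 0 ≤ x then 1 - Real.exp (-(extremeConst p * x ^ (p - 1))) else 0

end

/-! The event that every rescaled angle exceeds `x` says that no two of `n` independent points are
related, where related means being at angle at most `t = x / n^(2/(p-1))`. By rotational symmetry,
the points related to a given one have the same probability `c`, whichever point is given. For such
a relation, adding a point to `k` unrelated ones multiplies the probability by `1 - k c` up to an
error `k² c²` (`measureReal_unrelatedTuples_succ_sub_le`). Iterating gives `exp (-c n(n-1)/2)` with
error `O(n³ c²)`, which vanishes when `n² c` converges.

It remains to find `c`, the probability of a spherical cap of angular radius `t`. The solid cone
over the cap lies between two straight cones of slope `tan t`, whose volumes agree to leading order,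
so `n² c → 2 K x^(p-1)` (`tendsto_sq_mul_capProb`). The constant is a ratio of unit ball volumes in
dimensions `p - 1` and `p`.

The largest angle needs no separate argument: `π - angle x y = angle (-x) y`, so the balls of this
dissimilarity are caps as well. The distribution functions converge at every real point, which
yields weak convergence. -/

open scoped Topology Pointwise

/-! ### Probability that independent points contain no related pair -/

section UnrelatedTuples

variable {S : Type*} [MeasurableSpace S]

/-- The tuples no two of whose entries are related by `R`. -/
def unrelatedTuples (R : S → S → Prop) (n : ℕ) : Set (Fin n → S) :=
  {x | ∀ i j, i < j → ¬ R (x i) (x j)}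

lemma measurableSet_unrelatedTuples {R : S → S → Prop}
    (hR : MeasurableSet {q : S × S | R q.1 q.2}) (n : ℕ) :
    MeasurableSet (unrelatedTuples R n) := by
  have : unrelatedTuples R n = ⋂ i, ⋂ j, ⋂ (_ : i < j),
      ((fun x : Fin n → S => (x i, x j)) ⁻¹' {q : S × S | R q.1 q.2})ᶜ := by
    ext x
    simp [unrelatedTuples]
  rw [this]
  refine MeasurableSet.iInter fun i => MeasurableSet.iInter fun j => MeasurableSet.iInter fun _ => ?_
  exact (hR.preimage (by fun_prop)).compl

/-- A second-order Bonferroni inequality. -/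
lemma sum_measureReal_le_measureReal_biUnion_add {Ω ι : Type*} [MeasurableSpace Ω]
    (P : Measure Ω) [IsFiniteMeasure P] (B : ι → Set Ω) (hB : ∀ i, MeasurableSet (B i)) {ε : ℝ}
    (hε : ∀ i j, i ≠ j → P.real (B i ∩ B j) ≤ ε) (hε0 : 0 ≤ ε) (s : Finset ι) :
    ∑ i ∈ s, P.real (B i) ≤ P.real (⋃ i ∈ s, B i) + (s.card : ℝ) ^ 2 * ε := by
  classical
  induction s using Finset.induction_on with
  | empty => simp
  | insert a s ha ih =>
    rw [Finset.sum_insert ha, Finset.card_insert_of_notMem ha, Finset.set_biUnion_insert]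
    have hU : MeasurableSet (⋃ i ∈ s, B i) := s.measurableSet_biUnion fun i _ => hB i
    have h1 := measureReal_union_add_inter (μ := P) (s := B a) hU (measure_ne_top _ _)
      (measure_ne_top _ _)
    have h2 : P.real (B a ∩ ⋃ i ∈ s, B i) ≤ s.card * ε := by
      rw [Set.inter_iUnion₂]
      refine (measureReal_biUnion_finset_le _ _).trans ?_
      rw [← nsmul_eq_mul]
      refine Finset.sum_le_card_nsmul _ _ _ fun i hi => hε _ _ ?_
      rintro rfl
      exact ha hi
    push_cast
    have : 0 ≤ (s.card : ℝ) * ε := by positivity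
    nlinarith

variable {μ : Measure S} [IsProbabilityMeasure μ] {R : S → S → Prop} {c : ℝ}

/-- The new point spoils an unrelated `k`-tuple exactly on the union of the events `B i` that it is
related to the `i`-th entry. The union bound and the Bonferroni inequality enclose the measure of
this union. -/
lemma measureReal_unrelatedTuples_succ_sub_le (hR : MeasurableSet {q : S × S | R q.1 q.2})
    (hsymm : ∀ x y, R x y → R y x) (hc : ∀ x, μ.real {y | R x y} = c) (k : ℕ) :
    |(Measure.pi fun _ : Fin (k + 1) => μ).real (unrelatedTuples R (k + 1))
      - (1 - k * c) * (Measure.pi fun _ : Fin k => μ).real (unrelatedTuples R k)|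
      ≤ (k : ℝ) ^ 2 * c ^ 2 := by
  set π := Measure.pi fun _ : Fin k => μ with hπ
  set A := unrelatedTuples R k with hA
  have hAm : MeasurableSet A := measurableSet_unrelatedTuples hR k
  have hc0 : 0 ≤ c := by
    obtain ⟨x⟩ : Nonempty S := nonempty_of_isProbabilityMeasure μ
    exact hc x ▸ measureReal_nonneg
  have hcE : ∀ x, μ {y | R x y} = ENNReal.ofReal c := fun x => by
    rw [← hc x, ofReal_measureReal]
  have hsE : ∀ y, {x | R x y} = {x | R y x} := fun y => by
    ext x; exact ⟨hsymm _ _, hsymm _ _⟩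
  let B : Fin k → Set (S × (Fin k → S)) := fun i => {q | q.2 ∈ A ∧ R q.1 (q.2 i)}
  have hRi : ∀ i : Fin k, MeasurableSet {q : S × (Fin k → S) | R q.1 (q.2 i)} := fun i =>
    hR.preimage (f := fun q : S × (Fin k → S) => (q.1, q.2 i)) (by fun_prop)
  have hB : ∀ i, MeasurableSet (B i) := fun i => (measurable_snd hAm).inter (hRi i)
  -- Exact, because the old points are fixed first: the new point is related to `y i` with
  -- probability `c` whatever `y` is. Symmetry of `R` is used here.
  have hBi : ∀ i, (μ.prod π).real (B i) = c * π.real A := by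
    intro i
    have h : ∀ y, μ ((fun x => (x, y)) ⁻¹' B i) = A.indicator (fun _ => ENNReal.ofReal c) y := by
      intro y
      by_cases hy : y ∈ A
      · rw [Set.indicator_of_mem hy, ← hcE (y i), ← hsE]
        congr 1
        ext x
        simp [B, hy]
      · have : (fun x => (x, y)) ⁻¹' B i = ∅ := by
          ext x
          simp [B, hy]
        rw [this, Set.indicator_of_notMem hy, measure_empty]
    rw [measureReal_def, Measure.prod_apply_symm (hB i), lintegral_congr h,
      lintegral_indicator_const hAm, ENNReal.toReal_mul, ENNReal.toReal_ofReal hc0, measureReal_def]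
  -- Here the new point is fixed first: two distinct old points are then related to it
  -- independently. The condition that the old points are unrelated is dropped.
  have hBij : ∀ i j, i ≠ j → (μ.prod π).real (B i ∩ B j) ≤ c ^ 2 := by
    intro i j hij
    have hsub : B i ∩ B j ⊆ {q | R q.1 (q.2 i)} ∩ {q | R q.1 (q.2 j)} := fun q hq =>
      ⟨hq.1.2, hq.2.2⟩
    refine (measureReal_mono hsub).trans_eq ?_
    have h : ∀ x, π (Prod.mk x ⁻¹' ({q | R q.1 (q.2 i)} ∩ {q | R q.1 (q.2 j)}))
        = ENNReal.ofReal c ^ 2 := by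
      intro x
      have : Prod.mk x ⁻¹' ({q : S × (Fin k → S) | R q.1 (q.2 i)} ∩ {q | R q.1 (q.2 j)})
          = Set.univ.pi (fun l => if l ∈ ({i, j} : Finset (Fin k)) then {y | R x y}
            else Set.univ) := by
        ext y
        simp only [Set.mem_preimage, Set.mem_inter_iff, Set.mem_ofPred_eq, Set.mem_pi,
          Set.mem_univ, true_imp_iff]
        constructor
        · rintro ⟨h1, h2⟩ l
          split_ifs with hl
          · simp only [Finset.mem_insert, Finset.mem_singleton] at hl
            rcases hl with rfl | rfl <;> assumption
          · trivial
        · intro h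
          have h1 := h i
          have h2 := h j
          simp at h1 h2
          exact ⟨h1, h2⟩
      rw [this, hπ, Measure.pi_pi]
      simp only [apply_ite μ, measure_univ, hcE]
      rw [Finset.prod_ite_mem, Finset.univ_inter, Finset.prod_const, Finset.card_pair hij]
    rw [measureReal_def, Measure.prod_apply ((hRi i).inter (hRi j)), lintegral_congr h]
    simp [ENNReal.toReal_ofReal hc0]
  have hsucc : (Measure.pi fun _ : Fin (k + 1) => μ).real (unrelatedTuples R (k + 1))
      = π.real A - (μ.prod π).real (⋃ i ∈ Finset.univ, B i) := by
    -- The coordinate `0` plays the new point, the remaining ones the old `k`-tuple.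
    have hmp := measurePreserving_piFinSuccAbove (fun _ : Fin (k + 1) => μ) 0
    have hset : unrelatedTuples R (k + 1) = MeasurableEquiv.piFinSuccAbove (fun _ => S) 0 ⁻¹'
        ((Prod.snd ⁻¹' A) \ ⋃ i ∈ Finset.univ, B i) := by
      ext x
      simp only [unrelatedTuples, Set.mem_ofPred_eq, Set.mem_preimage, Set.mem_sdiff, Set.mem_iUnion,
        hA, B, MeasurableEquiv.piFinSuccAbove_apply, Finset.mem_univ, exists_prop, true_and,
        Fin.insertNthEquiv, Equiv.coe_fn_symm_mk, Fin.removeNth, Fin.succAbove_zero]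
      constructor
      · intro h
        refine ⟨fun i j hij => h _ _ (Fin.succ_lt_succ_iff.2 hij), ?_⟩
        rintro ⟨i, -, hi⟩
        exact h 0 i.succ (Fin.succ_pos i) hi
      · rintro ⟨h1, h2⟩ i j hij
        refine Fin.cases (fun hij => ?_) (fun i hij => ?_) i hij
        · obtain ⟨j, rfl⟩ := Fin.eq_succ_of_ne_zero hij.ne'
          exact fun hr => h2 ⟨j, h1, hr⟩
        · obtain ⟨j, rfl⟩ := Fin.eq_succ_of_ne_zero ((Fin.succ_pos i).trans hij).ne'
          exact h1 i j (Fin.succ_lt_succ_iff.1 hij)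
    have hUm : MeasurableSet (⋃ i ∈ Finset.univ, B i) :=
      Finset.univ.measurableSet_biUnion fun i _ => hB i
    rw [hset, measureReal_def, hmp.measure_preimage_equiv, ← measureReal_def]
    change (μ.prod π).real _ = _
    rw [measureReal_sdiff _ hUm]
    · congr 1
      rw [← Set.univ_prod, measureReal_prod_prod]
      simp
    · refine Set.iUnion₂_subset fun i _ q hq => hq.1
  have hsum : ∑ i ∈ Finset.univ, (μ.prod π).real (B i) = k * (c * π.real A) := by
    simp [hBi]
  have hle := measureReal_biUnion_finset_le (μ := μ.prod π) Finset.univ B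
  have hge := sum_measureReal_le_measureReal_biUnion_add (μ.prod π) B hB hBij (sq_nonneg c)
    Finset.univ
  rw [hsum] at hle hge
  rw [Finset.card_univ, Fintype.card_fin] at hge
  rw [hsucc, abs_le]
  have : 0 ≤ (k : ℝ) ^ 2 * c ^ 2 := by positivity
  constructor <;> linarith

/-- Both sequences satisfy nearly the same recursion, since `exp (-k c)` differs from `1 - k c` by
at most `(k c)²`. Each step adds at most `2 k² c²` to the error. -/
lemma measureReal_unrelatedTuples_sub_exp_le (hR : MeasurableSet {q : S × S | R q.1 q.2})
    (hsymm : ∀ x y, R x y → R y x) (hc : ∀ x, μ.real {y | R x y} = c) (n : ℕ) :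
    |(Measure.pi fun _ : Fin n => μ).real (unrelatedTuples R n)
      - Real.exp (-(c * (n * (n - 1) / 2)))| ≤ 2 * (n : ℝ) ^ 3 * c ^ 2 := by
  have hc0 : 0 ≤ c := by
    obtain ⟨x⟩ : Nonempty S := nonempty_of_isProbabilityMeasure μ
    exact hc x ▸ measureReal_nonneg
  induction n with
  | zero =>
    have : unrelatedTuples R 0 = Set.univ := by
      ext x; simp [unrelatedTuples]
    simp [this]
  | succ k ih =>
    have hstep := measureReal_unrelatedTuples_succ_sub_le hR hsymm hc k
    set a := (Measure.pi fun _ : Fin k => μ).real (unrelatedTuples R k)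
    set b := Real.exp (-(c * (k * (k - 1) / 2)))
    have ha0 : 0 ≤ a := measureReal_nonneg
    have ha1 : a ≤ 1 := measureReal_le_one
    have hx : 0 ≤ k * c := by positivity
    have hexp : Real.exp (-(c * ((k + 1 : ℕ) * ((k + 1 : ℕ) - 1) / 2)))
        = Real.exp (-(k * c)) * b := by
      rw [← Real.exp_add]
      congr 1
      push_cast
      ring
    have he0 := Real.exp_pos (-(k * c))
    have he1 : Real.exp (-(k * c)) ≤ 1 := Real.exp_le_one_iff.2 (by linarith)
    have hed : |1 - k * c - Real.exp (-(k * c))| ≤ (k * c) ^ 2 := by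
      rcases le_or_gt (k * c) 1 with h | h
      · have := Real.abs_exp_sub_one_sub_id_le (x := -(k * c)) (by rwa [abs_neg, abs_of_nonneg hx])
        rw [abs_sub_comm]
        convert this using 1
        · congr 1; ring
        · ring
      -- For `k c > 1` the difference is at most `k c` in absolute value, hence at most `(k c)²`.
      · rw [abs_le]; constructor <;> nlinarith
    rw [hexp]
    set a' := (Measure.pi fun _ : Fin (k + 1) => μ).real (unrelatedTuples R (k + 1))
    set e := Real.exp (-(k * c))
    have h1 : |e * (a - b)| ≤ 2 * (k : ℝ) ^ 3 * c ^ 2 := by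
      rw [abs_mul, abs_of_pos he0]
      exact (mul_le_of_le_one_left (abs_nonneg _) he1).trans ih
    have h2 : |(1 - k * c - e) * a| ≤ (k * c) ^ 2 := by
      rw [abs_mul, abs_of_nonneg ha0]
      exact (mul_le_of_le_one_right (abs_nonneg _) ha1).trans hed
    calc |a' - e * b| = |(a' - (1 - k * c) * a) + ((1 - k * c - e) * a) + e * (a - b)| := by
          congr 1; ring
      _ ≤ (k : ℝ) ^ 2 * c ^ 2 + (k * c) ^ 2 + 2 * (k : ℝ) ^ 3 * c ^ 2 :=
          (abs_add_three _ _ _).trans (by linarith)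
      _ ≤ 2 * ((k + 1 : ℕ) : ℝ) ^ 3 * c ^ 2 := by
          have hk : (0 : ℝ) ≤ k := k.cast_nonneg
          have : 0 ≤ (4 * (k : ℝ) ^ 2 + 6 * k + 2) * c ^ 2 := by positivity
          push_cast
          linarith

/-- The probability that no two of `n` independent points are related tends to `exp (-r)` if the
expected number of related pairs tends to `r`. -/
lemma tendsto_measureReal_unrelatedTuples {R : ℕ → S → S → Prop} {c : ℕ → ℝ} {r : ℝ}
    (hR : ∀ n, MeasurableSet {q : S × S | R n q.1 q.2})
    (hsymm : ∀ n x y, R n x y → R n y x) (hc : ∀ᶠ n in atTop, ∀ x, μ.real {y | R n x y} = c n)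
    (hlim : Tendsto (fun n : ℕ => (n : ℝ) ^ 2 * c n) atTop (𝓝 (2 * r))) :
    Tendsto (fun n : ℕ => (Measure.pi fun _ : Fin n => μ).real (unrelatedTuples (R n) n)) atTop
      (𝓝 (Real.exp (-r))) := by
  have hinv : Tendsto (fun n : ℕ => ((n : ℝ))⁻¹) atTop (𝓝 0) := tendsto_inv_atTop_nhds_zero_nat
  have h1 : Tendsto (fun n : ℕ => 2 * (n : ℝ) ^ 3 * c n ^ 2) atTop (𝓝 0) := by
    have := ((hlim.pow 2).mul hinv).const_mul 2
    simp only [mul_zero] at this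
    refine this.congr' ?_
    filter_upwards [eventually_ne_atTop 0] with n hn
    have : (n : ℝ) ≠ 0 := by exact_mod_cast hn
    field_simp
  have h2 : Tendsto (fun n : ℕ => Real.exp (-(c n * (n * (n - 1) / 2)))) atTop
      (𝓝 (Real.exp (-r))) := by
    refine (Real.continuous_exp.tendsto _).comp (Tendsto.neg ?_)
    have := (hlim.mul ((tendsto_const_nhds (x := (1 : ℝ))).sub hinv)).div_const 2
    rw [show 2 * r * (1 - 0) / 2 = r by ring] at this
    refine this.congr' ?_
    filter_upwards [eventually_ne_atTop 0] with n hn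
    have : (n : ℝ) ≠ 0 := by exact_mod_cast hn
    field_simp
  have h3 : Tendsto (fun n : ℕ => (Measure.pi fun _ : Fin n => μ).real (unrelatedTuples (R n) n)
      - Real.exp (-(c n * (n * (n - 1) / 2)))) atTop (𝓝 0) := by
    refine squeeze_zero_norm' ?_ h1
    filter_upwards [hc] with n hn
    exact measureReal_unrelatedTuples_sub_exp_le (hR n) (hsymm n) hn n
  simpa using h3.add h2

end UnrelatedTuples

noncomputable section
-- Measure of spherical caps of small radius
section SphericalCaps

/-- The vectors of length in `(0, 1)` that form an angle of at most `t` with `x`. -/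
def solidCone {p : ℕ} (x : EuclideanSpace ℝ (Fin p)) (t : ℝ) : Set (EuclideanSpace ℝ (Fin p)) :=
  {v | 0 < ‖v‖ ∧ ‖v‖ < 1 ∧ InnerProductGeometry.angle x v ≤ t}

/-- `Measure.toSphere` measures a set by the volume of the open cone over it, so this turns cap
measures into volumes. -/
lemma Ioo_smul_cap {p : ℕ} (x : UnitSphere p) (t : ℝ) :
    Set.Ioo (0 : ℝ) 1 • (Subtype.val '' {y : UnitSphere p |
      InnerProductGeometry.angle (x : EuclideanSpace ℝ (Fin p)) y ≤ t}) =
      solidCone (x : EuclideanSpace ℝ (Fin p)) t := by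
  ext v
  simp only [Set.mem_smul, Set.mem_image, solidCone, Set.mem_ofPred_eq]
  constructor
  · rintro ⟨r, ⟨hr0, hr1⟩, -, ⟨y, hy, rfl⟩, rfl⟩
    have hn : ‖r • (y : EuclideanSpace ℝ (Fin p))‖ = r := by
      rw [norm_smul, Real.norm_of_nonneg hr0.le, norm_eq_of_mem_sphere, mul_one]
    rw [hn, InnerProductGeometry.angle_smul_right_of_pos _ _ hr0]
    exact ⟨hr0, hr1, hy⟩
  · rintro ⟨h0, h1, h⟩
    refine ⟨‖v‖, ⟨h0, h1⟩, ‖v‖⁻¹ • v, ⟨⟨‖v‖⁻¹ • v, ?_⟩, ?_, rfl⟩, ?_⟩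
    · rw [mem_sphere_zero_iff_norm, norm_smul, norm_inv, norm_norm, inv_mul_cancel₀ h0.ne']
    · rwa [InnerProductGeometry.angle_smul_right_of_pos _ _ (inv_pos.2 h0)]
    · rw [smul_smul, mul_inv_cancel₀ h0.ne', one_smul]

lemma angle_sphere_eq_arccos {p : ℕ} (x y : UnitSphere p) :
    InnerProductGeometry.angle (x : EuclideanSpace ℝ (Fin p)) y
      = Real.arccos (inner ℝ (x : EuclideanSpace ℝ (Fin p)) y) := by
  simp [InnerProductGeometry.angle]

lemma continuous_angle_sphere (p : ℕ) : Continuous fun q : UnitSphere p × UnitSphere p =>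
    InnerProductGeometry.angle (q.1 : EuclideanSpace ℝ (Fin p)) q.2 := by
  simp_rw [angle_sphere_eq_arccos]
  fun_prop

lemma volume_solidCone_eq {p : ℕ} {x y : EuclideanSpace ℝ (Fin p)} (h : ‖x‖ = ‖y‖) (t : ℝ) :
    volume (solidCone x t) = volume (solidCone y t) := by
  -- The reflection in the hyperplane orthogonal to `x - y` exchanges two vectors of equal length.
  set L := (ℝ ∙ (x - y))ᗮ.reflection
  have hL : L x = y := Submodule.reflection_sub h
  have : solidCone x t = L ⁻¹' solidCone y t := by
    ext v
    simp only [solidCone, Set.mem_preimage, Set.mem_ofPred_eq, L.norm_map]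
    rw [← hL, ← L.toLinearIsometry.angle_map x v]
    rfl
  rw [this]
  exact L.measurePreserving.measure_preimage_equiv (f := L.toHomeomorph.toMeasurableEquiv) _

instance isProbabilityMeasure_uniformSphere (m : ℕ) :
    IsProbabilityMeasure (uniformSphere (m + 1)) := by
  refine cond_isProbabilityMeasure ?_
  rw [Ne, Measure.measure_univ_eq_zero]
  exact Measure.toSphere_ne_zero _

lemma uniformSphere_real_cap {m : ℕ} (x : UnitSphere (m + 1)) (t : ℝ) :
    (uniformSphere (m + 1)).real {y | InnerProductGeometry.angle
        (x : EuclideanSpace ℝ (Fin (m + 1))) y ≤ t}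
      = volume.real (solidCone (EuclideanSpace.single (0 : Fin (m + 1)) (1 : ℝ)) t)
        / volume.real (Metric.ball (0 : EuclideanSpace ℝ (Fin (m + 1))) 1) := by
  have hm : MeasurableSet {y : UnitSphere (m + 1) | InnerProductGeometry.angle
        (x : EuclideanSpace ℝ (Fin (m + 1))) y ≤ t} :=
    (isClosed_le ((continuous_angle_sphere _).comp (by fun_prop : Continuous fun y => (x, y)))
      continuous_const).measurableSet
  rw [uniformSphere, measureReal_def, ProbabilityTheory.cond_apply MeasurableSet.univ,
    Set.univ_inter, Measure.toSphere_apply' _ hm, Measure.toSphere_apply_univ, Ioo_smul_cap,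
    volume_solidCone_eq (y := EuclideanSpace.single (0 : Fin (m + 1)) (1 : ℝ)) (by simp)]
  simp only [ENNReal.toReal_mul, ENNReal.toReal_inv, measureReal_def, finrank_euclideanSpace,
    Fintype.card_fin, ENNReal.toReal_natCast]
  have : ((m + 1 : ℕ) : ℝ) ≠ 0 := by positivity
  field_simp

/-- Splitting off the first coordinate of a vector. -/
def euclideanSplit (m : ℕ) (v : EuclideanSpace ℝ (Fin (m + 1))) : ℝ × EuclideanSpace ℝ (Fin m) :=
  (v 0, WithLp.toLp 2 fun i => v i.succ)

lemma measurePreserving_euclideanSplit (m : ℕ) :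
    MeasurePreserving (euclideanSplit m) volume volume := by
  have h1 := EuclideanSpace.volume_preserving_symm_measurableEquiv_toLp (Fin (m + 1))
  have h2 := volume_preserving_piFinSuccAbove (fun _ : Fin (m + 1) => ℝ) 0
  have h3 := (MeasurePreserving.id (volume : Measure ℝ)).prod (PiLp.volume_preserving_toLp (Fin m))
  exact (h3.comp h2).comp h1

lemma norm_sq_euclideanSplit {m : ℕ} (v : EuclideanSpace ℝ (Fin (m + 1))) :
    ‖v‖ ^ 2 = (euclideanSplit m v).1 ^ 2 + ‖(euclideanSplit m v).2‖ ^ 2 := by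
  simp [EuclideanSpace.norm_sq_eq, euclideanSplit, Fin.sum_univ_succ]

/-- The cone of height `a` and slope `s` over a ball. -/
def straightCone (m : ℕ) (a s : ℝ) : Set (ℝ × EuclideanSpace ℝ (Fin m)) :=
  {q | (0 < q.1 ∧ q.1 < a) ∧ ‖q.2‖ ≤ q.1 * s}

lemma measurableSet_straightCone (m : ℕ) (a s : ℝ) : MeasurableSet (straightCone m a s) := by
  refine MeasurableSet.inter (MeasurableSet.inter ?_ ?_) ?_
  · exact measurableSet_lt measurable_const measurable_fst
  · exact measurableSet_lt measurable_fst measurable_const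
  · exact measurableSet_le measurable_snd.norm (measurable_fst.mul_const _)

lemma volume_straightCone (m : ℕ) {a s : ℝ} (ha : 0 ≤ a) (hs : 0 ≤ s) :
    volume (straightCone m a s) = ENNReal.ofReal (s ^ m * a ^ (m + 1) / (m + 1)
      * volume.real (Metric.ball (0 : EuclideanSpace ℝ (Fin m)) 1)) := by
  set w := volume.real (Metric.ball (0 : EuclideanSpace ℝ (Fin m)) 1) with hw
  have hw0 : 0 ≤ w := measureReal_nonneg
  have hslice : ∀ h : ℝ, volume (Prod.mk h ⁻¹' straightCone m a s)
      = (Set.Ioo 0 a).indicator (fun h => ENNReal.ofReal (h ^ m * (s ^ m * w))) h := by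
    intro h
    by_cases hh : h ∈ Set.Ioo 0 a
    · have : Prod.mk h ⁻¹' straightCone m a s = Metric.closedBall 0 (h * s) := by
        ext z
        simp [straightCone, hh.1, hh.2]
      have hhs : 0 ≤ h * s := mul_nonneg hh.1.le hs
      rw [this, Set.indicator_of_mem hh, Measure.addHaar_closedBall _ _ hhs,
        ← ofReal_measureReal (s := Metric.ball (0 : EuclideanSpace ℝ (Fin m)) 1)
          measure_ball_lt_top.ne, ← hw, ← ENNReal.ofReal_mul (by positivity)]
      congr 1
      simp [mul_pow, mul_assoc]
    · have : Prod.mk h ⁻¹' straightCone m a s = ∅ := by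
        ext z
        simp only [straightCone, Set.mem_preimage, Set.mem_ofPred_eq, Set.mem_empty_iff_false,
          iff_false]
        exact fun hz => hh hz.1
      rw [this, Set.indicator_of_notMem hh, measure_empty]
  rw [Measure.volume_eq_prod, Measure.prod_apply (measurableSet_straightCone m a s),
    lintegral_congr hslice, lintegral_indicator measurableSet_Ioo,
    ← ofReal_integral_eq_lintegral_ofReal]
  · congr 1
    rw [← integral_Ioc_eq_integral_Ioo, ← intervalIntegral.integral_of_le ha,
      intervalIntegral.integral_mul_const, integral_pow]
    simp
    ring
  · exact (Continuous.integrableOn_Icc (by fun_prop)).mono_set Set.Ioo_subset_Icc_self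
  · refine (ae_restrict_iff' measurableSet_Ioo).2 (ae_of_all _ fun h hh => ?_)
    have := hh.1.le
    simp only [Pi.zero_apply]
    positivity

lemma angle_le_iff_euclideanSplit {m : ℕ} {v : EuclideanSpace ℝ (Fin (m + 1))} (hv : 0 < ‖v‖)
    {t : ℝ} (ht0 : 0 ≤ t) (ht : t < Real.pi / 2) :
    InnerProductGeometry.angle (EuclideanSpace.single (0 : Fin (m + 1)) (1 : ℝ)) v ≤ t ↔
      0 < (euclideanSplit m v).1 ∧
        ‖(euclideanSplit m v).2‖ ≤ (euclideanSplit m v).1 * Real.tan t := by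
  have hcos : 0 < Real.cos t := Real.cos_pos_of_mem_Ioo ⟨by linarith, ht⟩
  have hsin : 0 ≤ Real.sin t := Real.sin_nonneg_of_nonneg_of_le_pi ht0 (by linarith)
  have hcs := Real.sin_sq_add_cos_sq t
  have hn := norm_sq_euclideanSplit v
  have hangle : InnerProductGeometry.angle (EuclideanSpace.single (0 : Fin (m + 1)) (1 : ℝ)) v
      = Real.arccos ((euclideanSplit m v).1 / ‖v‖) := by
    simp [InnerProductGeometry.angle, euclideanSplit, EuclideanSpace.inner_single_left]
  have hle : Real.arccos ((euclideanSplit m v).1 / ‖v‖) ≤ t ↔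
      ‖v‖ * Real.cos t ≤ (euclideanSplit m v).1 := by
    have h1 : |(euclideanSplit m v).1 / ‖v‖| ≤ 1 := by
      rw [abs_div, abs_norm, div_le_one hv]
      exact abs_le_of_sq_le_sq (by nlinarith [sq_nonneg ‖(euclideanSplit m v).2‖]) hv.le
    rw [abs_le] at h1
    rw [mul_comm, ← le_div_iff₀ hv]
    constructor
    · intro h
      have := Real.cos_le_cos_of_nonneg_of_le_pi (Real.arccos_nonneg _) (by linarith) h
      rwa [Real.cos_arccos h1.1 h1.2] at this
    · intro h
      have := Real.arccos_le_arccos h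
      rwa [Real.arccos_cos ht0 (by linarith)] at this
  rw [hangle, hle, Real.tan_eq_sin_div_cos, mul_div_assoc', le_div_iff₀ hcos]
  set h := (euclideanSplit m v).1
  set z := ‖(euclideanSplit m v).2‖
  have hz : 0 ≤ z := norm_nonneg _
  have key : (z * Real.cos t) ^ 2 ≤ (h * Real.sin t) ^ 2 ↔ (‖v‖ * Real.cos t) ^ 2 ≤ h ^ 2 := by
    rw [mul_pow, mul_pow, mul_pow, hn, show Real.sin t ^ 2 = 1 - Real.cos t ^ 2 by linarith]
    constructor <;> intro h <;> linarith
  constructor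
  · intro H
    have h0 : 0 < h := (mul_pos hv hcos).trans_le H
    refine ⟨h0, abs_le_of_sq_le_sq' (key.2 ?_) (by positivity) |>.2⟩
    exact pow_le_pow_left₀ (by positivity) H 2
  · rintro ⟨h0, H⟩
    exact abs_le_of_sq_le_sq' (key.1 (pow_le_pow_left₀ (by positivity) H 2)) h0.le |>.2

/-- A vector of the unit ball has first coordinate below `1`, so the straight cone of height `1`
contains the solid cone. -/
lemma volume_real_solidCone_le {m : ℕ} {t : ℝ} (ht0 : 0 ≤ t) (ht : t < Real.pi / 2) :
    volume.real (solidCone (EuclideanSpace.single (0 : Fin (m + 1)) (1 : ℝ)) t)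
      ≤ Real.tan t ^ m / (m + 1) * volume.real (Metric.ball (0 : EuclideanSpace ℝ (Fin m)) 1) := by
  have htan : 0 ≤ Real.tan t := Real.tan_nonneg_of_nonneg_of_le_pi_div_two ht0 ht.le
  have hsub : solidCone (EuclideanSpace.single (0 : Fin (m + 1)) (1 : ℝ)) t
      ⊆ euclideanSplit m ⁻¹' straightCone m 1 (Real.tan t) := by
    rintro v ⟨hv0, hv1, hv⟩
    obtain ⟨h0, hz⟩ := (angle_le_iff_euclideanSplit hv0 ht0 ht).1 hv
    refine ⟨⟨h0, ?_⟩, hz⟩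
    have hn := norm_sq_euclideanSplit v
    nlinarith [sq_nonneg ‖(euclideanSplit m v).2‖]
  have hvol := (measurePreserving_euclideanSplit m).measure_preimage
    (measurableSet_straightCone m 1 (Real.tan t)).nullMeasurableSet
  have h := volume_straightCone m zero_le_one htan
  rw [one_pow, mul_one] at h
  refine (measureReal_mono hsub (by rw [hvol, h]; exact ENNReal.ofReal_ne_top)).trans_eq ?_
  rw [measureReal_def, hvol, h, ENNReal.toReal_ofReal (by positivity)]

/-- The straight cone of height `cos t` and slope `tan t` has its rim on the unit sphere, so it fits
inside the solid cone. -/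
lemma le_volume_real_solidCone {m : ℕ} {t : ℝ} (ht0 : 0 ≤ t) (ht : t < Real.pi / 2) :
    Real.tan t ^ m * Real.cos t ^ (m + 1) / (m + 1)
        * volume.real (Metric.ball (0 : EuclideanSpace ℝ (Fin m)) 1)
      ≤ volume.real (solidCone (EuclideanSpace.single (0 : Fin (m + 1)) (1 : ℝ)) t) := by
  have htan : 0 ≤ Real.tan t := Real.tan_nonneg_of_nonneg_of_le_pi_div_two ht0 ht.le
  have hcos : 0 < Real.cos t := Real.cos_pos_of_mem_Ioo ⟨by linarith, ht⟩
  have hsub : euclideanSplit m ⁻¹' straightCone m (Real.cos t) (Real.tan t)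
      ⊆ solidCone (EuclideanSpace.single (0 : Fin (m + 1)) (1 : ℝ)) t := by
    rintro v ⟨⟨h0, h1⟩, hz⟩
    have hn := norm_sq_euclideanSplit v
    have hv0 : 0 < ‖v‖ := by
      refine norm_pos_iff.2 ?_
      rintro rfl
      simp [euclideanSplit] at h0
    refine ⟨hv0, ?_, (angle_le_iff_euclideanSplit hv0 ht0 ht).2 ⟨h0, hz⟩⟩
    have hsq := pow_le_pow_left₀ (norm_nonneg _) hz 2
    have htc : Real.tan t * Real.cos t = Real.sin t := Real.tan_mul_cos hcos.ne'
    have hcs := Real.sin_sq_add_cos_sq t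
    have h2 : ‖v‖ ^ 2 * Real.cos t ^ 2 < 1 * Real.cos t ^ 2 := by
      calc ‖v‖ ^ 2 * Real.cos t ^ 2
          ≤ (euclideanSplit m v).1 ^ 2 * (Real.cos t ^ 2 + (Real.tan t * Real.cos t) ^ 2) := by
            rw [hn]
            nlinarith [mul_le_mul_of_nonneg_right hsq (sq_nonneg (Real.cos t))]
        _ = (euclideanSplit m v).1 ^ 2 := by rw [htc, add_comm, hcs, mul_one]
        _ < 1 * Real.cos t ^ 2 := by rw [one_mul]; exact pow_lt_pow_left₀ h1 h0.le two_ne_zero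
    have h3 := lt_of_mul_lt_mul_right h2 (by positivity)
    nlinarith
  have hvol := (measurePreserving_euclideanSplit m).measure_preimage
    (measurableSet_straightCone m (Real.cos t) (Real.tan t)).nullMeasurableSet
  have hfin : volume (solidCone (EuclideanSpace.single (0 : Fin (m + 1)) (1 : ℝ)) t) ≠ ⊤ := by
    refine ne_top_of_le_ne_top (measure_ball_lt_top (x := (0 : EuclideanSpace ℝ (Fin (m + 1))))
      (r := 1)).ne (measure_mono fun v hv => ?_)
    simpa using hv.2.1
  refine le_trans (le_of_eq ?_) (measureReal_mono hsub hfin)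
  rw [measureReal_def (s := euclideanSplit m ⁻¹' _), hvol, volume_straightCone m hcos.le htan,
    ENNReal.toReal_ofReal (by positivity)]

lemma volume_real_unitBall_euclidean (m : ℕ) :
    volume.real (Metric.ball (0 : EuclideanSpace ℝ (Fin (m + 1))) 1)
      = √Real.pi ^ (m + 1) / Real.Gamma ((m + 1 : ℕ) / 2 + 1) := by
  have : 0 < Real.Gamma ((m + 1 : ℕ) / 2 + 1) := Real.Gamma_pos_of_pos (by positivity)
  rw [measureReal_def, EuclideanSpace.volume_ball]
  simp only [ENNReal.ofReal_one, one_pow, one_mul, Fintype.card_fin]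
  rw [ENNReal.toReal_ofReal (by positivity)]

lemma volume_real_unitBall_ratio (m : ℕ) :
    volume.real (Metric.ball (0 : EuclideanSpace ℝ (Fin (m + 1))) 1)
        / (((m + 1 : ℕ) + 1) * volume.real (Metric.ball (0 : EuclideanSpace ℝ (Fin (m + 2))) 1))
      = 2 * extremeConst (m + 2) := by
  rw [volume_real_unitBall_euclidean, volume_real_unitBall_euclidean, extremeConst]
  have h1 : 0 < Real.Gamma ((m + 2 : ℝ) / 2) := Real.Gamma_pos_of_pos (by positivity)
  have h2 : 0 < Real.Gamma ((m + 3 : ℝ) / 2) := Real.Gamma_pos_of_pos (by positivity)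
  have e1 : Real.Gamma ((m + 1 : ℕ) / 2 + 1) = Real.Gamma ((m + 3 : ℝ) / 2) := by
    congr 1; push_cast; ring
  have e2 : Real.Gamma ((m + 1 + 1 : ℕ) / 2 + 1) =
      (m + 2 : ℝ) / 2 * Real.Gamma ((m + 2 : ℝ) / 2) := by
    rw [← Real.Gamma_add_one (by positivity)]
    congr 1; push_cast; ring
  have e3 : Real.Gamma ((((m + 2 : ℕ) : ℝ) + 1) / 2) = Real.Gamma ((m + 3 : ℝ) / 2) := by
    congr 1; push_cast; ring
  rw [e1, e2, e3]
  have hpi : 0 < √Real.pi := Real.sqrt_pos.2 Real.pi_pos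
  push_cast
  field_simp
  ring

/-- The probability of a spherical cap of angular radius `t`. -/
def capProb (p : ℕ) (t : ℝ) : ℝ :=
  ⨆ x : UnitSphere p, (uniformSphere p).real
    {y | InnerProductGeometry.angle (x : EuclideanSpace ℝ (Fin p)) y ≤ t}

/-- The supremum defining `capProb` is over a constant family. -/
lemma capProb_eq (m : ℕ) (t : ℝ) : capProb (m + 1) t =
    volume.real (solidCone (EuclideanSpace.single (0 : Fin (m + 1)) (1 : ℝ)) t)
      / volume.real (Metric.ball (0 : EuclideanSpace ℝ (Fin (m + 1))) 1) := by
  have : Nonempty (UnitSphere (m + 1)) :=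
    nonempty_of_isProbabilityMeasure (uniformSphere (m + 1))
  simp [capProb, uniformSphere_real_cap]

lemma uniformSphere_real_cap_eq_capProb (m : ℕ) (x : UnitSphere (m + 1)) (t : ℝ) :
    (uniformSphere (m + 1)).real {y | InnerProductGeometry.angle
      (x : EuclideanSpace ℝ (Fin (m + 1))) y ≤ t} = capProb (m + 1) t := by
  rw [capProb_eq, uniformSphere_real_cap]

/-- This is the derivative of `u ↦ tan (x u)` at `0`, read along `u = 1 / s`. -/
lemma tendsto_mul_tan_div (x : ℝ) : Tendsto (fun s : ℝ => s * Real.tan (x / s)) atTop (𝓝 x) := by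
  have hd : HasDerivAt (fun u : ℝ => Real.tan (x * u)) x 0 := by
    have h1 : HasDerivAt (fun u : ℝ => x * u) x 0 := by
      simpa using (hasDerivAt_id (0 : ℝ)).const_mul x
    have h2 : HasDerivAt Real.tan (1 / Real.cos 0 ^ 2) (x * 0) := by
      rw [mul_zero]
      exact Real.hasDerivAt_tan (by simp)
    have h3 := h2.comp (0 : ℝ) h1
    simp only [Real.cos_zero, one_pow, div_one, one_mul] at h3
    exact h3
  have hinv : Tendsto (fun s : ℝ => s⁻¹) atTop (𝓝[≠] 0) :=
    tendsto_inv_atTop_nhdsGT_zero.mono_right (nhdsWithin_mono _ fun y hy => ne_of_gt hy)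
  have := (hasDerivAt_iff_tendsto_slope_zero.1 hd).comp hinv
  refine this.congr fun s => ?_
  simp [div_eq_mul_inv]

lemma tendsto_sq_mul_capProb {p : ℕ} (hp : 2 ≤ p) {x : ℝ} (hx : 0 ≤ x) :
    Tendsto (fun n : ℕ => (n : ℝ) ^ 2 * capProb p (x / (n : ℝ) ^ ((2 : ℝ) / ((p : ℝ) - 1)))) atTop
      (𝓝 (2 * (extremeConst p * x ^ (p - 1)))) := by
  obtain ⟨m, rfl⟩ : ∃ m, p = m + 2 := ⟨p - 2, by omega⟩
  have he : (2 : ℝ) / (((m + 2 : ℕ) : ℝ) - 1) = 2 / (m + 1 : ℕ) := by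
    push_cast; congr 1; ring
  rw [he, show m + 2 - 1 = m + 1 by omega]
  set s : ℕ → ℝ := fun n => (n : ℝ) ^ ((2 : ℝ) / (m + 1 : ℕ)) with hs
  -- This explains the exponent `2/(p-1)`: the factor `n²` is absorbed into the power of `tan (x / s
  -- n)`.
  have hspow : ∀ n, s n ^ (m + 1) = (n : ℝ) ^ 2 := by
    intro n
    rw [hs, ← Real.rpow_natCast, ← Real.rpow_mul n.cast_nonneg, div_mul_cancel₀ _ (by positivity)]
    norm_cast
  have hst : Tendsto s atTop atTop :=
    (tendsto_rpow_atTop (by positivity)).comp tendsto_natCast_atTop_atTop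
  have h0 : Tendsto (fun n => x / s n) atTop (𝓝 0) := hst.const_div_atTop x
  have htan := (((tendsto_mul_tan_div x).comp hst).pow (m + 1)).const_mul (2 * extremeConst (m + 2))
  have hcos : Tendsto (fun n => Real.cos (x / s n) ^ (m + 2)) atTop (𝓝 1) := by
    have := ((Real.continuous_cos.tendsto 0).comp h0).pow (m + 2)
    simpa using this
  have hlow := htan.mul hcos
  rw [mul_one, mul_assoc] at hlow
  rw [mul_assoc] at htan
  have hpos : 0 < volume.real (Metric.ball (0 : EuclideanSpace ℝ (Fin (m + 2))) 1) :=
    ENNReal.toReal_pos (Metric.measure_ball_pos _ _ one_pos).ne' measure_ball_lt_top.ne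
  have hev : ∀ᶠ n in atTop, 0 ≤ x / s n ∧ x / s n < Real.pi / 2 := by
    filter_upwards [h0.eventually_lt_const (by positivity : 0 < Real.pi / 2),
      hst.eventually_gt_atTop 0] with n h1 h2
    exact ⟨by positivity, h1⟩
  -- The two cone bounds differ only by the factor `cos (x / s n) ^ (m + 2)`, which tends to `1`.
  refine tendsto_of_tendsto_of_tendsto_of_le_of_le' hlow htan ?_ ?_
  · filter_upwards [hev] with n ⟨h1, h2⟩
    have := le_volume_real_solidCone (m := m + 1) h1 h2
    change _ ≤ _ * capProb (m + 2) (x / s n)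
    rw [capProb_eq (m + 1), ← volume_real_unitBall_ratio, ← hspow]
    simp only [Function.comp, mul_pow]
    refine le_trans (le_of_eq ?_) (mul_le_mul_of_nonneg_left
      (div_le_div_of_nonneg_right this hpos.le) (by rw [hspow]; positivity))
    push_cast
    field_simp
  · filter_upwards [hev] with n ⟨h1, h2⟩
    have := volume_real_solidCone_le (m := m + 1) h1 h2
    change _ * capProb (m + 2) (x / s n) ≤ _
    rw [capProb_eq (m + 1), ← volume_real_unitBall_ratio, ← hspow]
    simp only [Function.comp, mul_pow]
    refine le_trans (mul_le_mul_of_nonneg_left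
      (div_le_div_of_nonneg_right this hpos.le) (by rw [hspow]; positivity)) (le_of_eq ?_)
    push_cast
    field_simp

end SphericalCaps

/-! ### Limit law of the extreme angles -/

section Convergence

/-- Pointwise convergence of the distribution functions implies weak convergence. -/
lemma tendsto_probabilityMeasure_of_tendsto_cdf {ι : Type*} {l : Filter ι}
    [l.IsCountablyGenerated] {μ : ι → ProbabilityMeasure ℝ} {ν : ProbabilityMeasure ℝ}
    (h : ∀ x, Tendsto (fun i => cdf (μ i : Measure ℝ) x) l (𝓝 (cdf (ν : Measure ℝ) x))) :
    Tendsto μ l (𝓝 ν) := by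
  have hIoc : ∀ (ρ : ProbabilityMeasure ℝ) {a b : ℝ}, a < b →
      (ρ : Measure ℝ).real (Set.Ioc a b) = cdf (ρ : Measure ℝ) b - cdf (ρ : Measure ℝ) a := by
    intro ρ a b hab
    rw [cdf_eq_real, cdf_eq_real, ← Set.Iic_sdiff_Iic,
      measureReal_sdiff (Set.Iic_subset_Iic.2 hab.le) measurableSet_Iic]
  -- Half-open intervals form a π-system containing arbitrarily small neighbourhoods of each point,
  -- so convergence of their measures suffices.
  refine (isPiSystem_Ioc (id : ℝ → ℝ) (id : ℝ → ℝ)).tendsto_probabilityMeasure_of_tendsto_of_mem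
    ?_ ?_ ?_
  · rintro s ⟨a, b, -, rfl⟩
    exact measurableSet_Ioc
  · intro u hu x hx
    obtain ⟨ε, hε, hball⟩ := Metric.isOpen_iff.1 hu x hx
    refine ⟨Set.Ioc (x - ε / 2) (x + ε / 2), ⟨_, _, ?_, rfl⟩, ?_, ?_⟩
    · simp only [id]; linarith
    · exact Ioc_mem_nhds (by linarith) (by linarith)
    · refine Set.Subset.trans (fun y hy => ?_) hball
      rw [Metric.mem_ball, Real.dist_eq, abs_lt]
      constructor <;> linarith [hy.1, hy.2]
  · rintro s ⟨a, b, hab, rfl⟩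
    rw [← NNReal.tendsto_coe]
    change Tendsto (fun i => (μ i : Measure ℝ).real (Set.Ioc a b)) l
      (𝓝 ((ν : Measure ℝ).real (Set.Ioc a b)))
    simp_rw [fun ρ => hIoc ρ (show a < b from hab)]
    exact (h b).sub (h a)

lemma extremeConst_pos {p : ℕ} (hp : 2 ≤ p) : 0 < extremeConst p := by
  have hp' : (0 : ℝ) < p := by positivity
  have h1 := Real.Gamma_pos_of_pos (half_pos hp')
  have h2 := Real.Gamma_pos_of_pos (half_pos (by linarith : (0 : ℝ) < p + 1))
  have := Real.pi_pos
  unfold extremeConst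
  positivity

lemma extremeCDF_eq_max {p : ℕ} (hp : 2 ≤ p) (x : ℝ) :
    extremeCDF p x = 1 - Real.exp (-(extremeConst p * (max x 0) ^ (p - 1))) := by
  unfold extremeCDF
  split_ifs with h
  · rw [max_eq_left h]
  · rw [max_eq_right (not_le.1 h).le, zero_pow (by omega)]
    simp

lemma monotone_extremeCDF {p : ℕ} (hp : 2 ≤ p) : Monotone (extremeCDF p) := by
  intro x y hxy
  have hK := (extremeConst_pos hp).le
  rw [extremeCDF_eq_max hp, extremeCDF_eq_max hp]
  gcongr

lemma continuous_extremeCDF {p : ℕ} (hp : 2 ≤ p) : Continuous (extremeCDF p) := by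
  rw [funext (extremeCDF_eq_max hp)]
  fun_prop

lemma exists_probabilityMeasure_cdf_eq_extremeCDF {p : ℕ} (hp : 2 ≤ p) :
    ∃ ν : ProbabilityMeasure ℝ, ∀ x : ℝ, cdf (ν : Measure ℝ) x = extremeCDF p x := by
  let f : StieltjesFunction ℝ :=
    ⟨extremeCDF p, monotone_extremeCDF hp, fun x => (continuous_extremeCDF hp).continuousWithinAt⟩
  have h0 : Tendsto f atBot (𝓝 0) := by
    refine tendsto_const_nhds.congr' ?_
    filter_upwards [eventually_lt_atBot 0] with x hx
    exact (if_neg (not_le.2 hx)).symm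
  have h1 : Tendsto f atTop (𝓝 1) := by
    have h : Tendsto (fun x : ℝ => extremeConst p * x ^ (p - 1)) atTop atTop :=
      (tendsto_pow_atTop (by omega)).const_mul_atTop (extremeConst_pos hp)
    have h2 := (Real.tendsto_exp_neg_atTop_nhds_zero.comp h).const_sub 1
    rw [sub_zero] at h2
    refine h2.congr' ?_
    filter_upwards [eventually_ge_atTop 0] with x hx
    exact (if_pos hx).symm
  have hprob : IsProbabilityMeasure f.measure :=
    ⟨by rw [f.measure_univ h0 h1, sub_zero, ENNReal.ofReal_one]⟩
  refine ⟨⟨f.measure, hprob⟩, fun x => ?_⟩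
  change cdf f.measure x = _
  rw [cdf_measure_stieltjesFunction f h0 h1]

lemma measurable_pairAngle {p n : ℕ} (i j : Fin n) :
    Measurable fun x : Fin n → UnitSphere p => pairAngle x i j := by
  unfold pairAngle
  simp_rw [angle_sphere_eq_arccos]
  fun_prop

lemma measurable_minAngle (p n : ℕ) : Measurable (minAngle : (Fin n → UnitSphere p) → ℝ) := by
  unfold minAngle
  exact Measurable.iInf fun q => measurable_pairAngle _ _

lemma measurable_maxAngle (p n : ℕ) : Measurable (maxAngle : (Fin n → UnitSphere p) → ℝ) := by
  unfold maxAngle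
  exact Measurable.iSup fun q => measurable_pairAngle _ _

lemma nonempty_pairs {n : ℕ} (hn : 2 ≤ n) : Nonempty {q : Fin n × Fin n // q.1 < q.2} :=
  ⟨⟨(⟨0, by omega⟩, ⟨1, by omega⟩), by simp⟩⟩

/-- A finite nonempty family attains its infimum, which gives the strict inequality. Without pairs
the infimum is the default `0` and the equivalence can fail. -/
lemma lt_minAngle_iff {p n : ℕ} (hn : 2 ≤ n) (x : Fin n → UnitSphere p) (t : ℝ) :
    t < minAngle x ↔ ∀ i j, i < j → t < pairAngle x i j := by
  have := nonempty_pairs hn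
  constructor
  · intro h i j hij
    exact h.trans_le (ciInf_le (Set.finite_range _).bddBelow
      (⟨(i, j), hij⟩ : {q : Fin n × Fin n // q.1 < q.2}))
  · intro h
    obtain ⟨q, hq⟩ := exists_eq_ciInf_of_finite
      (f := fun q : {q : Fin n × Fin n // q.1 < q.2} => pairAngle x q.1.1 q.1.2)
    rw [minAngle, ← hq]
    exact h _ _ q.2

lemma lt_pi_sub_maxAngle_iff {p n : ℕ} (hn : 2 ≤ n) (x : Fin n → UnitSphere p) (t : ℝ) :
    t < Real.pi - maxAngle x ↔ ∀ i j, i < j → t < Real.pi - pairAngle x i j := by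
  have := nonempty_pairs hn
  constructor
  · intro h i j hij
    refine h.trans_le (sub_le_sub_left ?_ _)
    exact le_ciSup (f := fun q : {q : Fin n × Fin n // q.1 < q.2} => pairAngle x q.1.1 q.1.2)
      (Set.finite_range _).bddAbove ⟨(i, j), hij⟩
  · intro h
    obtain ⟨q, hq⟩ := exists_eq_ciSup_of_finite
      (f := fun q : {q : Fin n × Fin n // q.1 < q.2} => pairAngle x q.1.1 q.1.2)
    rw [maxAngle, ← hq]
    exact h _ _ q.2

/-- If `T n` is the minimum over all pairs of a dissimilarity whose balls have the measure of
spherical caps, then the rescaled `T n` has the limiting distribution function `extremeCDF p`. -/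
lemma tendstoInDistribution_of_minimal_dissimilarity {p : ℕ} (hp : 2 ≤ p)
    {Ω : ℕ → Type*} [∀ n, MeasurableSpace (Ω n)]
    (P : ∀ n, Measure (Ω n)) [∀ n, IsProbabilityMeasure (P n)]
    (X : ∀ n, Fin n → Ω n → UnitSphere p)
    (hlaw : ∀ n i, HasLaw (X n i) (uniformSphere p) (P n))
    (hindep : ∀ n, iIndepFun (X n) (P n))
    {T : ∀ n, (Fin n → UnitSphere p) → ℝ} (hT : ∀ n, Measurable (T n))
    {δ : UnitSphere p → UnitSphere p → ℝ} (hδ : Continuous fun q : UnitSphere p × UnitSphere p =>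
      δ q.1 q.2) (hsymm : ∀ x y, δ x y = δ y x) (hδ0 : ∀ x y, 0 ≤ δ x y)
    (hcap : ∀ x t, (uniformSphere p).real {y | δ x y ≤ t} = capProb p t)
    (hTδ : ∀ n, 2 ≤ n → ∀ x t, t < T n x ↔ ∀ i j, i < j → t < δ (x i) (x j))
    {ν : ProbabilityMeasure ℝ} (hν : ∀ x : ℝ, cdf (ν : Measure ℝ) x = extremeCDF p x) :
    TendstoInDistribution
      (fun (n : ℕ) (ω : Ω n) => (n : ℝ) ^ ((2 : ℝ) / ((p : ℝ) - 1)) * T n (fun i => X n i ω))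
      atTop (id : ℝ → ℝ) P (ν : Measure ℝ) := by
  have : IsProbabilityMeasure (uniformSphere p) := by
    obtain ⟨m, rfl⟩ : ∃ m, p = m + 1 := ⟨p - 1, by omega⟩
    infer_instance
  have hXm : ∀ n, AEMeasurable (fun ω i => X n i ω) (P n) := fun n =>
    aemeasurable_pi_lambda _ fun i => (hlaw n i).aemeasurable
  have hmap : ∀ n, (P n).map (fun ω i => X n i ω) = Measure.pi fun _ => uniformSphere p := by
    intro n
    rw [(hindep n).map_fun_eq_pi_map fun i => (hlaw n i).aemeasurable]
    simp_rw [fun i => (hlaw n i).map_eq]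
  have hS : ∀ n : ℕ, AEMeasurable (fun ω => (n : ℝ) ^ ((2 : ℝ) / ((p : ℝ) - 1)) *
      T n (fun i => X n i ω)) (P n) := fun n =>
    ((hT n).comp_aemeasurable (hXm n)).const_mul _
  refine ⟨hS, aemeasurable_id, ?_⟩
  simp only [Measure.map_id]
  refine tendsto_probabilityMeasure_of_tendsto_cdf fun x => ?_
  change Tendsto (fun n => cdf ((P n).map _) x) _ (𝓝 (cdf (ν : Measure ℝ) x))
  rw [hν]
  set s : ℕ → ℝ := fun n => (n : ℝ) ^ ((2 : ℝ) / ((p : ℝ) - 1)) with hs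
  have hspos : ∀ n, 2 ≤ n → 0 < s n := fun n hn => Real.rpow_pos_of_pos (by positivity) _
  have hRm : ∀ n, MeasurableSet {q : UnitSphere p × UnitSphere p | δ q.1 q.2 ≤ x / s n} :=
    fun n => (isClosed_le hδ continuous_const).measurableSet
  have hcdf : ∀ n, 2 ≤ n → cdf ((P n).map fun ω => s n * T n (fun i => X n i ω)) x
      = 1 - (Measure.pi fun _ : Fin n => uniformSphere p).real
          (unrelatedTuples (fun y z => δ y z ≤ x / s n) n) := by
    intro n hn
    have := Measure.isProbabilityMeasure_map (hS n)
    have hset : unrelatedTuples (fun y z => δ y z ≤ x / s n) n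
        = {y | s n * T n y ≤ x}ᶜ := by
      ext y
      simp only [unrelatedTuples, Set.mem_ofPred_eq, Set.mem_compl_iff, not_le]
      rw [← hTδ n hn, div_lt_iff₀' (hspos n hn)]
    have hm : MeasurableSet {y | s n * T n y ≤ x} :=
      measurableSet_le ((hT n).const_mul _) measurable_const
    rw [cdf_eq_real, hset, probReal_compl_eq_one_sub hm, sub_sub_cancel, ← hmap n,
      map_measureReal_apply_of_aemeasurable (hS n) measurableSet_Iic,
      map_measureReal_apply_of_aemeasurable (hXm n) hm]
    rfl
  have hlim : Tendsto (fun n => 1 - (Measure.pi fun _ : Fin n => uniformSphere p).real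
      (unrelatedTuples (fun y z => δ y z ≤ x / s n) n)) atTop (𝓝 (extremeCDF p x)) := by
    unfold extremeCDF
    split_ifs with hx
    · exact (tendsto_measureReal_unrelatedTuples (R := fun n y z => δ y z ≤ x / s n) hRm
        (fun n y z h => hsymm y z ▸ h) (Eventually.of_forall fun n y => hcap y _)
        (tendsto_sq_mul_capProb hp hx)).const_sub 1
    -- For `x < 0` the threshold is negative, so no pair is ever related and the distribution
    -- function is `0` from `n = 2` on.
    · refine tendsto_const_nhds.congr' ?_
      filter_upwards [eventually_ge_atTop 2] with n hn
      have hneg : x / s n < 0 := div_neg_of_neg_of_pos (not_le.1 hx) (hspos n hn)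
      have huniv : unrelatedTuples (fun y z => δ y z ≤ x / s n) n = Set.univ :=
        Set.eq_univ_of_forall fun y i j _ => not_le.2 (hneg.trans_le (hδ0 _ _))
      rw [huniv]
      simp
  refine hlim.congr' ?_
  filter_upwards [eventually_ge_atTop 2] with n hn
  exact (hcdf n hn).symm

end Convergence
end

theorem theorem2 (p : ℕ) (hp : 2 ≤ p)
    {Ω : ℕ → Type*} [∀ n, MeasurableSpace (Ω n)]
    (P : ∀ n, Measure (Ω n)) [∀ n, IsProbabilityMeasure (P n)]
    (X : ∀ n, Fin n → Ω n → UnitSphere p)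
    (hlaw : ∀ n i, HasLaw (X n i) (uniformSphere p) (P n))
    (hindep : ∀ n, iIndepFun (X n) (P n)) :
    ∃ ν : ProbabilityMeasure ℝ,
      (∀ x : ℝ, cdf (ν : Measure ℝ) x = extremeCDF p x) ∧
      TendstoInDistribution
        (fun (n : ℕ) (ω : Ω n) =>
          (n : ℝ) ^ ((2 : ℝ) / ((p : ℝ) - 1)) * minAngle (fun i => X n i ω))
        atTop (id : ℝ → ℝ) P (ν : Measure ℝ) ∧
      TendstoInDistribution
        (fun (n : ℕ) (ω : Ω n) =>
          (n : ℝ) ^ ((2 : ℝ) / ((p : ℝ) - 1)) * (Real.pi - maxAngle (fun i => X n i ω)))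
        atTop (id : ℝ → ℝ) P (ν : Measure ℝ) := by
  obtain ⟨ν, hν⟩ := exists_probabilityMeasure_cdf_eq_extremeCDF hp
  have hcap : ∀ (x : UnitSphere p) t, (uniformSphere p).real {y | InnerProductGeometry.angle
      (x : EuclideanSpace ℝ (Fin p)) y ≤ t} = capProb p t := by
    obtain ⟨m, rfl⟩ : ∃ m, p = m + 1 := ⟨p - 1, by omega⟩
    exact uniformSphere_real_cap_eq_capProb m
  refine ⟨ν, hν, ?_, ?_⟩
  · exact tendstoInDistribution_of_minimal_dissimilarity hp P X hlaw hindep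
      (T := fun n => minAngle) (fun n => measurable_minAngle p n)
      (δ := fun x y => InnerProductGeometry.angle (x : EuclideanSpace ℝ (Fin p)) y)
      (continuous_angle_sphere p) (fun x y => InnerProductGeometry.angle_comm _ _)
      (fun x y => InnerProductGeometry.angle_nonneg _ _) hcap
      (fun n hn x t => lt_minAngle_iff hn x t) hν
  · refine tendstoInDistribution_of_minimal_dissimilarity hp P X hlaw hindep
      (T := fun n x => Real.pi - maxAngle x) (fun n => (measurable_maxAngle p n).const_sub _)
      (δ := fun x y => Real.pi - InnerProductGeometry.angle (x : EuclideanSpace ℝ (Fin p)) y)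
      (continuous_const.sub (continuous_angle_sphere p))
      (fun x y => by rw [InnerProductGeometry.angle_comm])
      (fun x y => sub_nonneg.2 (InnerProductGeometry.angle_le_pi _ _)) (fun x t => ?_)
      (fun n hn x t => lt_pi_sub_maxAngle_iff hn x t) hν
    -- The points nearly antipodal to `x` form the cap around `-x`.
    rw [← hcap (-x) t]
    simp_rw [← InnerProductGeometry.angle_neg_left]
    rfl
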